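/- All graphs are simple. A graph $\Gamma$ is edge-transitive (respectively dart-transitive) if its automorphism group acts transitively on its edges (respectively on its ordered pairs of adjacent vertices), and tetravalent if every vertex has exactly four neighbours. For $n\ge 1$ and a subset $S\subseteq\mathbb{Z}_n\setminus\{0\}$ with $S=-S$, the circulant graph $C_n(S)$ has vertex set $\mathbb{Z}_n$, with $i,j$ adjacent if and only if $i-j\in S$; a graph isomorphic to some $C_n(S)$ is called a circulant graph on $n$ vertices. For $a,b\in\mathbb{Z}_n$, $C_n(a,b)$ is the graph on $\mathbb{Z}_n$ in which distinct $i,j$ are adjacent if and only if $i-j\in\{\pm a,\pm b\}$. The wreath graph $W(m,2)$ has vertex set $\mathbb{Z}_m\times\mathbb{Z}_2$ and edges all pairs $\{(i,r),(i+1,s)\}$. Theorem. Let $\Gamma$ be a tetravalent edge-transitive circulant graph on $n$ vertices. Then $\Gamma$ is dart-transitive. If moreover $\Gamma$ is connected, then at least one of the following holds: (1) $\Gamma$ is isomorphic to $C_n(1,a)$ for some $a$ with $a^2\equiv \pm1 \pmod n$; (2) $n=2m$ is even and $\Gamma$ is isomorphic to $C_{2m}(1,m+1)$. Conversely, for every $n\ge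 1$ and every $a\in\mathbb{Z}_n$ with $a^2\equiv\pm1\pmod n$, the graph $C_n(1,a)$ is edge-transitive; and for every $m\ge 3$ the graph $C_{2m}(1,m+1)$ is tetravalent, edge-transitive, and isomorphic to the wreath graph $W(m,2)$. -/

import Mathlib

/-- Tetravalent: every vertex has exactly four neighbours. -/
def IsTetravalent {V : Type*} (G : SimpleGraph V) : Prop :=
  ∀ v : V, (G.neighborSet v).ncard = 4

/-- The automorphism group acts transitively on the edges (unordered pairs). -/
def IsEdgeTransitive {V : Type*} (G : SimpleGraph V) : Prop :=
  ∀ e ∈ G.edgeSet, ∀ f ∈ G.edgeSet, ∃ φ : G ≃g G, Sym2.map φ e = f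

/-- The automorphism group acts transitively on the darts (ordered pairs of adjacent vertices). -/
def IsDartTransitive {V : Type*} (G : SimpleGraph V) : Prop :=
  ∀ u v x y : V, G.Adj u v → G.Adj x y → ∃ φ : G ≃g G, φ u = x ∧ φ v = y

/-- `G` is, up to isomorphism, a circulant graph on `n` vertices: the Cayley graph of `ZMod n`
for a subset `S` closed under negation and not containing `0`. -/
def IsCirculant {V : Type*} (G : SimpleGraph V) (n : ℕ) : Prop :=
  ∃ S : Set (ZMod n), (0 : ZMod n) ∉ S ∧ (∀ x ∈ S, -x ∈ S) ∧
    Nonempty (G ≃g SimpleGraph.circulantGraph S)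

/-- The two-jump circulant `C_n(a, b)`: distinct `i`, `j` are adjacent iff
`i - j` is one of `a`, `-a`, `b`, `-b`. -/
def twoJumpCirculant (n : ℕ) (a b : ZMod n) : SimpleGraph (ZMod n) :=
  SimpleGraph.circulantGraph {a, -a, b, -b}

/-- The wreath graph `W(n, k)`: vertices `ZMod n × ZMod k`, edges the pairs
`{(i, r), (i + 1, s)}`. -/
def wreathGraph (n k : ℕ) : SimpleGraph (ZMod n × ZMod k) :=
  SimpleGraph.fromRel fun x y => y.1 = x.1 + 1

/-! The reflection `x ↦ u + v - x` reverses the edge `uv` of a circulant, so edge-transitivity gives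
dart-transitivity. As `ZMod n` has at most one involution, a tetravalent connection set is `{±a,
±b}`, and connectedness gives `a * x + b * y = 1`.

If nonzero sums of two jumps determine their summands, the four-cycles are rigid enough that an
automorphism fixing `0` is additive (`circulantGraph_automorphism_map_add`), hence multiplication by
some `u`. Choosing it to send `a` to `b` forces `u * b = ±a`; then `a` is a unit, `u ^ 2 = ±1`, and
division by `a` gives `C_n(1, u)`.

Unique sums fail only for a few relations. If `2 * a = ±(2 * b)`, the jumps differ, up to sign, by
the involution and the graph is `C_{2m}(1, m + 1)`. If `b = ±3a` (or vice versa), or just one of `4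
* a`, `4 * b` vanishes, two darts lie on different numbers of four-cycles, contradicting
dart-transitivity; the exception is `10 * a = 0` with `b = ±3a`, where `3` serves as `u` up to sign.

Conversely, `{±1, ±a}` is a multiplicative group acting on `C_n(1, a)`, and reduction mod `m`
exhibits `C_{2m}(1, m + 1)` as a wreath graph. -/

theorem IsDartTransitive.isEdgeTransitive {V : Type*} {G : SimpleGraph V}
    (h : IsDartTransitive G) : IsEdgeTransitive G := by
  intro e
  induction e with | _ u v
  intro he f
  induction f with | _ x y
  intro hf
  obtain ⟨φ, h1, h2⟩ := h u v x y he hf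
  exact ⟨φ, by simp [h1, h2]⟩

theorem IsEdgeTransitive.of_iso {V W : Type*} {G : SimpleGraph V} {H : SimpleGraph W}
    (e : G ≃g H) (h : IsEdgeTransitive G) : IsEdgeTransitive H := by
  intro x
  induction x with | _ u v
  intro he f
  induction f with | _ x y
  intro hf
  obtain ⟨φ, hφ⟩ := h s(e.symm u, e.symm v) (e.symm.map_adj_iff.2 he) s(e.symm x, e.symm y)
    (e.symm.map_adj_iff.2 hf)
  refine ⟨(e.symm.trans φ).trans e, ?_⟩
  have := congrArg (Sym2.map e) hφ
  simpa using this

theorem IsDartTransitive.of_iso {V W : Type*} {G : SimpleGraph V} {H : SimpleGraph W}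
    (e : G ≃g H) (h : IsDartTransitive G) : IsDartTransitive H := by
  intro u v x y huv hxy
  obtain ⟨φ, h1, h2⟩ := h (e.symm u) (e.symm v) (e.symm x) (e.symm y) (e.symm.map_adj_iff.2 huv)
    (e.symm.map_adj_iff.2 hxy)
  exact ⟨(e.symm.trans φ).trans e, by simp [h1], by simp [h2]⟩

theorem IsTetravalent.of_iso {V W : Type*} {G : SimpleGraph V} {H : SimpleGraph W}
    (e : G ≃g H) (h : IsTetravalent G) : IsTetravalent H := by
  intro v
  rw [← h (e.symm v), ← Nat.card_coe_set_eq, ← Nat.card_coe_set_eq]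
  simpa using (Nat.card_congr (e.mapNeighborSet (e.symm v))).symm

/-! ### Circulant graphs over an abelian group and rigidity of their automorphisms -/

section Circulant

variable {A : Type*} [AddCommGroup A] {S : Set A}

theorem circulantGraph_adj_iff (h0 : (0 : A) ∉ S) (hS : ∀ x ∈ S, -x ∈ S) {u v : A} :
    (SimpleGraph.circulantGraph S).Adj u v ↔ v - u ∈ S := by
  simp only [SimpleGraph.circulantGraph, SimpleGraph.fromRel_adj]
  constructor
  · rintro ⟨-, h | h⟩
    · simpa using hS _ h
    · exact h
  · intro h
    exact ⟨fun e => h0 (by simpa [e] using h), Or.inr h⟩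

theorem circulantGraph_isDartTransitive (h0 : (0 : A) ∉ S) (hS : ∀ x ∈ S, -x ∈ S)
    (h : IsEdgeTransitive (SimpleGraph.circulantGraph S)) :
    IsDartTransitive (SimpleGraph.circulantGraph S) := by
  intro u v x y huv hxy
  obtain ⟨φ, hφ⟩ := h s(u, v) huv s(x, y) hxy
  rw [Sym2.map_mk, Sym2.eq_iff] at hφ
  rcases hφ with hφ | hφ
  · exact ⟨φ, hφ⟩
  · let ψ : SimpleGraph.circulantGraph S ≃g SimpleGraph.circulantGraph S :=
      { toEquiv := Equiv.subLeft (u + v)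
        map_rel_iff' := by
          intro p q
          simp only [Equiv.subLeft_apply, circulantGraph_adj_iff h0 hS]
          rw [show u + v - q - (u + v - p) = -(q - p) by abel]
          exact ⟨fun h => by simpa using hS _ h, hS _⟩ }
    refine ⟨ψ.trans φ, ?_, ?_⟩
    · change φ (u + v - u) = x
      simpa using hφ.2
    · change φ (u + v - v) = y
      simpa using hφ.1

theorem circulantGraph_neighborSet_ncard (h0 : (0 : A) ∉ S) (hS : ∀ x ∈ S, -x ∈ S) (v : A) :
    ((SimpleGraph.circulantGraph S).neighborSet v).ncard = S.ncard := by
  have : (SimpleGraph.circulantGraph S).neighborSet v = (fun x => v + x) '' S := by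
    ext w
    simp only [SimpleGraph.mem_neighborSet, circulantGraph_adj_iff h0 hS, Set.mem_image]
    exact ⟨fun h => ⟨_, h, by abel⟩, by rintro ⟨x, hx, rfl⟩; simpa using hx⟩
  rw [this, Set.ncard_image_of_injective _ (add_right_injective v)]

/-- A walk from `x` to `0` writes `x` as a sum of elements of `S`. -/
theorem circulantGraph_closure_eq_top (h0 : (0 : A) ∉ S) (hS : ∀ x ∈ S, -x ∈ S)
    (hc : (SimpleGraph.circulantGraph S).Connected) : AddSubgroup.closure S = ⊤ := by
  rw [eq_top_iff]
  rintro x -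
  obtain ⟨p⟩ := hc.preconnected x 0
  generalize hz : (0 : A) = z at p
  induction p with
  | nil => subst hz; exact zero_mem _
  | cons hadj p ih =>
    have h1 := AddSubgroup.subset_closure ((circulantGraph_adj_iff h0 hS).1 hadj)
    have h2 := sub_mem (ih hz) h1
    simpa using h2

/-- If nonzero sums of two elements of the connection set determine the summands, two neighbours
`v + s`, `v + t` of `v` have no common neighbours besides `v` and `v + s + t`. -/
theorem circulantGraph_common_neighbor (h0 : (0 : A) ∉ S) (hS : ∀ x ∈ S, -x ∈ S)
    (hu : ∀ s ∈ S, ∀ t ∈ S, ∀ p ∈ S, ∀ q ∈ S, s + t = p + q → s + t ≠ 0 → p = s ∨ p = t)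
    {v w s t : A} (hs : s ∈ S) (ht : t ∈ S) (hst : s ≠ t)
    (h1 : (SimpleGraph.circulantGraph S).Adj (v + s) w)
    (h2 : (SimpleGraph.circulantGraph S).Adj (v + t) w) : w = v ∨ w = v + s + t := by
  rw [circulantGraph_adj_iff h0 hS] at h1 h2
  have := hu s hs (-t) (hS _ ht) _ h2 _ (hS _ h1) (by abel) (by rwa [← sub_eq_add_neg, sub_ne_zero])
  rcases this with h | h
  · right; rw [sub_eq_iff_eq_add] at h; rw [h]; abel
  · left; rw [sub_eq_iff_eq_add] at h; rw [h]; abel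

/-- Under the same condition, automorphisms fixing `0` are additive. -/
theorem circulantGraph_automorphism_map_add (h0 : (0 : A) ∉ S) (hS : ∀ x ∈ S, -x ∈ S)
    (hu : ∀ s ∈ S, ∀ t ∈ S, ∀ p ∈ S, ∀ q ∈ S, s + t = p + q → s + t ≠ 0 → p = s ∨ p = t)
    (h2 : ∀ s ∈ S, s ≠ -s) (hgen : AddSubgroup.closure S = ⊤)
    (φ : SimpleGraph.circulantGraph S ≃g SimpleGraph.circulantGraph S) (hφ : φ 0 = 0) (v w : A) :
    φ (v + w) = φ v + φ w := by
  have adj : ∀ {u v : A}, (SimpleGraph.circulantGraph S).Adj u v ↔ v - u ∈ S :=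
    circulantGraph_adj_iff h0 hS
  have hD : ∀ v s, s ∈ S → φ (v + s) - φ v ∈ S := fun v s hs => by
    rw [← adj, φ.map_adj_iff, adj]; simpa using hs
  have hne : ∀ v s t, s ≠ t → φ (v + s) - φ v ≠ φ (v + t) - φ v := fun v s t hst h =>
    hst (by simpa using h)
  -- The fourth corner over the images of `v + s` and `v - s` is `φ z` with `z` a common neighbour
  -- of `v ± s`. Only `z = v` is possible, so the two increments cancel.
  have hodd : ∀ v s, s ∈ S → φ (v + -s) - φ v = -(φ (v + s) - φ v) := by
    intro v s hs
    by_contra hcon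
    obtain ⟨z, hz⟩ := φ.surjective (φ v + (φ (v + s) - φ v) + (φ (v + -s) - φ v))
    have key : z = v ∨ z = v + s + -s := by
      refine circulantGraph_common_neighbor h0 hS hu hs (hS _ hs) (h2 s hs) ?_ ?_
      · rw [← φ.map_adj_iff, adj, hz]
        convert hD v _ (hS _ hs) using 1; abel
      · rw [← φ.map_adj_iff, adj, hz]
        convert hD v _ hs using 1; abel
    have hzv : z = v := by rcases key with h | h <;> simpa using h
    rw [hzv] at hz
    apply hcon
    rw [eq_neg_iff_add_eq_zero, add_comm]
    have := hz.symm
    rwa [add_assoc, add_eq_left] at this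
  -- Opposite sides of a parallelogram keep equal increments. The flat cases `t = ±s` come from
  -- `hodd`; otherwise `φ (v + s + t)` is the common neighbour other than `φ v`.
  have hpar : ∀ v s t, s ∈ S → t ∈ S → φ (v + s + t) - φ (v + s) = φ (v + t) - φ v := by
    intro v s t hs ht
    by_cases e1 : t = -s
    · subst e1
      rw [hodd v s hs]; simp
    by_cases e2 : t = s
    · subst e2
      have := hodd (v + t) t hs
      rw [add_neg_cancel_right] at this
      rw [← neg_inj, ← this]; abel
    have key := circulantGraph_common_neighbor (v := φ v) (w := φ (v + s + t)) h0 hS hu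
      (hD v s hs) (hD v t ht) (hne v s t (Ne.symm e2))
      (by rw [add_sub_cancel, φ.map_adj_iff, adj]; simpa using ht)
      (by rw [add_sub_cancel, φ.map_adj_iff, adj]; convert hs using 1; abel)
    rcases key with h | h
    · exfalso
      apply e1
      have := φ.injective h
      rw [add_assoc, add_eq_left] at this
      exact (neg_eq_of_add_eq_zero_right this).symm
    · rw [h]; abel
  -- The increment along `s` is unchanged by translation by `S`, hence by the group it generates.
  have hconst : ∀ w ∈ AddSubgroup.closure S, ∀ v s, s ∈ S →
      φ (v + w + s) - φ (v + w) = φ (v + s) - φ v := by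
    intro w hw
    induction hw using AddSubgroup.closure_induction with
    | mem x hx => exact fun v s hs => hpar v x s hx hs
    | zero => simp
    | add x y _ _ hx hy =>
      intro v s hs
      rw [← hx v s hs, ← hy (v + x) s hs, add_assoc v x y]
    | neg x _ hx =>
      intro v s hs
      rw [← hx (v + -x) s hs, neg_add_cancel_right]
  have hlin : ∀ v s, s ∈ S → φ (v + s) = φ v + φ s := by
    intro v s hs
    have := hconst v (hgen ▸ AddSubgroup.mem_top v) 0 s hs
    rw [zero_add, zero_add, hφ, sub_zero, sub_eq_iff_eq_add'] at this
    exact this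
  have hw : w ∈ AddSubgroup.closure S := hgen ▸ AddSubgroup.mem_top w
  induction hw using AddSubgroup.closure_induction generalizing v with
  | mem x hx => exact hlin v x hx
  | zero => simp [hφ]
  | add x y _ _ hx hy => rw [← add_assoc, hy, hx, hy x, add_assoc]
  | neg x _ hx =>
    have e1 := hx (v + -x)
    have e2 := hx (-x)
    rw [neg_add_cancel_right] at e1
    rw [neg_add_cancel, hφ] at e2
    rw [e1, add_assoc, add_comm (φ x), ← e2, add_zero]

end Circulant

/-! ### Involutions in `ZMod n` and symmetric four-element sets -/

theorem ZMod.eq_natCast_of_two_mul_eq_zero {n : ℕ} (hn : 0 < n) {d : ZMod n} (hd : d ≠ 0)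
    (h2 : 2 * d = 0) : ∃ m : ℕ, n = 2 * m ∧ d = (m : ZMod n) := by
  have : NeZero n := ⟨hn.ne'⟩
  refine ⟨d.val, ?_, by simp⟩
  have hlt := d.val_lt
  have hpos : d.val ≠ 0 := by simpa using hd
  have hdvd : n ∣ 2 * d.val := by
    rw [← ZMod.natCast_eq_zero_iff]; simpa using h2
  obtain ⟨k, hk⟩ := hdvd
  have : k < 2 := by
    by_contra! hk2
    nlinarith
  interval_cases k <;> omega

theorem ZMod.eq_of_two_mul_eq_zero {n : ℕ} (hn : 0 < n) {x y : ZMod n} (hx : x ≠ 0)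
    (hx2 : 2 * x = 0) (hy : y ≠ 0) (hy2 : 2 * y = 0) : x = y := by
  obtain ⟨m, h1, rfl⟩ := ZMod.eq_natCast_of_two_mul_eq_zero hn hx hx2
  obtain ⟨k, h3, rfl⟩ := ZMod.eq_natCast_of_two_mul_eq_zero hn hy hy2
  rw [show m = k by omega]

/-- Only the parity of an integer lift of `x` matters. -/
theorem ZMod.mul_eq_zero_or_self_of_two_mul_eq_zero {n : ℕ} {d : ZMod n}
    (h2 : 2 * d = 0) (x : ZMod n) : d * x = 0 ∨ d * x = d := by
  obtain ⟨k, rfl⟩ := ZMod.intCast_surjective x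
  rcases Int.even_or_odd' k with ⟨j, rfl | rfl⟩
  · left; push_cast; linear_combination (j : ZMod n) * h2
  · right; push_cast; linear_combination (j : ZMod n) * h2

/-- A symmetric four-element subset of `ZMod n` avoiding zero consists of two pairs `±a`, `±b`. -/
theorem ZMod.exists_eq_of_ncard_eq_four {n : ℕ} (hn : 0 < n) {S : Set (ZMod n)}
    (h0 : (0 : ZMod n) ∉ S) (hS : ∀ x ∈ S, -x ∈ S) (h4 : S.ncard = 4) :
    ∃ a b : ZMod n, S = {a, -a, b, -b} ∧ 2 * a ≠ 0 ∧ 2 * b ≠ 0 ∧ a ≠ b ∧ a ≠ -b := by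
  have inv : ∀ x ∈ S, ∀ y ∈ S, 2 * x = 0 → 2 * y = 0 → x = y := fun x hx y hy h1 h2 =>
    ZMod.eq_of_two_mul_eq_zero hn (fun h => h0 (h ▸ hx)) h1 (fun h => h0 (h ▸ hy)) h2
  have hne : ∀ x : ZMod n, 2 * x ≠ 0 ↔ x ≠ -x := fun x => by
    rw [not_iff_not, two_mul, eq_neg_iff_add_eq_zero]
  obtain ⟨a, haS, ha⟩ : ∃ a ∈ S, 2 * a ≠ 0 := by
    by_contra! hcon
    obtain ⟨x, y, hx, hy, hxy⟩ := (Set.one_lt_ncard_iff (Set.finite_of_ncard_ne_zero (by omega))).1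
      (show 1 < S.ncard by omega)
    exact hxy (inv x hx y hy (hcon x hx) (hcon y hy))
  have hfin : S.Finite := Set.finite_of_ncard_ne_zero (by omega)
  have hsub : ({a, -a} : Set (ZMod n)) ⊆ S := by
    rintro x (rfl | rfl)
    exacts [haS, hS _ haS]
  have h2 : (S \ {a, -a}).ncard = 2 := by
    rw [Set.ncard_sdiff hsub, h4, Set.ncard_pair ((hne a).1 ha)]
  obtain ⟨b, c, hbc, hT⟩ := Set.ncard_eq_two.1 h2
  have hST : S = {a, -a, b, c} := by
    rw [← Set.union_sdiff_cancel hsub, hT]; ext; simp; tauto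
  have hb : b ∈ S \ {a, -a} := by rw [hT]; simp
  have hc : c ∈ S \ {a, -a} := by rw [hT]; simp
  have hneg : ∀ x ∈ S \ {a, -a}, -x ∈ S \ {a, -a} := by
    rintro x ⟨hx, hxa⟩
    refine ⟨hS _ hx, ?_⟩
    simp only [Set.mem_insert_iff, Set.mem_singleton_iff, neg_inj] at hxa ⊢
    rintro (h | h)
    · exact hxa (Or.inr (by rw [← h, neg_neg]))
    · exact hxa (Or.inl h)
  have hb' := hneg b hb
  have hc' := hneg c hc
  rw [hT] at hb' hc'
  simp only [Set.mem_insert_iff, Set.mem_singleton_iff] at hb' hc'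
  have hba := hb.2
  simp only [Set.mem_insert_iff, Set.mem_singleton_iff, not_or] at hba
  -- Otherwise `b` and `c` would be two distinct involutions.
  have key : -b = c := by
    rcases hb' with h | h
    · rcases hc' with h' | h'
      · rw [← h', neg_neg]
      · exact absurd (inv b hb.1 c hc.1 (by linear_combination -h) (by linear_combination -h')) hbc
    · exact h
  subst key
  refine ⟨a, b, hST, ha, (hne b).2 hbc, Ne.symm hba.1, ?_⟩
  rintro h
  exact hba.2 (by rw [h, neg_neg])

/-! ### Two-jump circulants and their jump sets -/

theorem twoJumpCirculant_comm (n : ℕ) (a b : ZMod n) :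
    twoJumpCirculant n a b = twoJumpCirculant n b a := by
  unfold twoJumpCirculant
  congr 1; ext; simp; tauto

theorem twoJumpCirculant_neg_right (n : ℕ) (a b : ZMod n) :
    twoJumpCirculant n a (-b) = twoJumpCirculant n a b := by
  unfold twoJumpCirculant
  congr 1; ext; simp; tauto

theorem twoJumpCirculant_iso_mul {n : ℕ} (u : (ZMod n)ˣ) (a b : ZMod n) :
    Nonempty (twoJumpCirculant n (u * a) (u * b) ≃g twoJumpCirculant n a b) := by
  refine ⟨RelIso.symm { toEquiv := u.mulLeft, map_rel_iff' := ?_ }⟩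
  intro x y
  have h : ∀ p q r : ZMod n, (u : ZMod n) * p - u * q = u * r ↔ p - q = r := fun p q r => by
    rw [← mul_sub]; exact u.mul_right_inj
  simp only [twoJumpCirculant, SimpleGraph.circulantGraph, SimpleGraph.fromRel_adj, ne_eq,
    Units.mulLeft_apply, Units.mul_right_inj, Set.mem_insert_iff, Set.mem_singleton_iff, ← mul_neg,
    h]

section JumpSet

variable {n : ℕ} {a b : ZMod n}

theorem neg_mem_jumpSet (x : ZMod n) (hx : x ∈ ({a, -a, b, -b} : Set (ZMod n))) :
    -x ∈ ({a, -a, b, -b} : Set (ZMod n)) := by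
  rcases hx with rfl | rfl | rfl | rfl <;> simp

theorem zero_notMem_jumpSet (ha : a ≠ 0) (hb : b ≠ 0) :
    (0 : ZMod n) ∉ ({a, -a, b, -b} : Set (ZMod n)) := by
  simp [ha.symm, hb.symm, ha, hb]

theorem twoJumpCirculant_adj (ha : a ≠ 0) (hb : b ≠ 0) {u v : ZMod n} :
    (twoJumpCirculant n a b).Adj u v ↔ v - u ∈ ({a, -a, b, -b} : Set (ZMod n)) :=
  circulantGraph_adj_iff (zero_notMem_jumpSet ha hb) neg_mem_jumpSet

/-- The subgroup generated by the jumps lies in the ideal `(a, b)`, which therefore contains `1`. -/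
theorem exists_mul_add_mul_eq_one (h : AddSubgroup.closure ({a, -a, b, -b} : Set (ZMod n)) = ⊤) :
    ∃ x y : ZMod n, a * x + b * y = 1 := by
  have hle : AddSubgroup.closure ({a, -a, b, -b} : Set (ZMod n)) ≤
      (Ideal.span {a, b}).toAddSubgroup := by
    rw [AddSubgroup.closure_le]
    have ha : a ∈ Ideal.span {a, b} := Ideal.subset_span (by simp)
    have hb : b ∈ Ideal.span {a, b} := Ideal.subset_span (by simp)
    rintro x (rfl | rfl | rfl | rfl)
    exacts [ha, neg_mem ha, hb, neg_mem hb]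
  have h1 : (1 : ZMod n) ∈ Ideal.span {a, b} := hle (h ▸ AddSubgroup.mem_top 1)
  obtain ⟨x, y, hxy⟩ := Ideal.mem_span_pair.1 h1
  exact ⟨x, y, by rw [← hxy]; ring⟩

set_option maxHeartbeats 2000000 in
/-- A nonzero sum of two elements of `{±a, ±b}` determines its summands, outside degenerate cases. -/
theorem jumpSet_sum_unique (ha : 2 * a ≠ 0) (hb : 2 * b ≠ 0) (hab : a ≠ b) (hab' : a ≠ -b)
    (h1 : 2 * a ≠ 2 * b) (h2 : 2 * a ≠ -(2 * b)) (h3 : 4 * a ≠ 0) (h4 : 4 * b ≠ 0)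
    (h5 : b ≠ 3 * a) (h6 : b ≠ -(3 * a)) (h7 : a ≠ 3 * b) (h8 : a ≠ -(3 * b)) :
    ∀ s ∈ ({a, -a, b, -b} : Set (ZMod n)), ∀ t ∈ ({a, -a, b, -b} : Set (ZMod n)),
    ∀ p ∈ ({a, -a, b, -b} : Set (ZMod n)), ∀ q ∈ ({a, -a, b, -b} : Set (ZMod n)),
      s + t = p + q → s + t ≠ 0 → p = s ∨ p = t := by
  intro s hs t ht p hp q hq h h0
  by_contra! hcon
  obtain ⟨e1, e2⟩ := hcon
  rcases hs with rfl | rfl | rfl | rfl <;> rcases ht with rfl | rfl | rfl | rfl <;>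
    rcases hp with rfl | rfl | rfl | rfl <;> first | exact e1 rfl | exact e2 rfl | skip
  all_goals rcases hq with rfl | rfl | rfl | rfl <;> grind

end JumpSet

/-! ### Counting four-cycles through a dart -/

/-- The pairs `(x, y)` such that `u, v, x, y` is a closed walk of length four with
`x ≠ u` and `y ≠ v`. -/
def fourCycleCompletions {V : Type*} (G : SimpleGraph V) (u v : V) : Set (V × V) :=
  {p | G.Adj v p.1 ∧ G.Adj p.1 p.2 ∧ G.Adj p.2 u ∧ p.1 ≠ u ∧ p.2 ≠ v}

theorem IsDartTransitive.fourCycleCompletions_ncard_le {V : Type*} [Finite V] {G : SimpleGraph V}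
    (h : IsDartTransitive G) {u v x y : V} (huv : G.Adj u v) (hxy : G.Adj x y) :
    (fourCycleCompletions G u v).ncard ≤ (fourCycleCompletions G x y).ncard := by
  obtain ⟨φ, rfl, rfl⟩ := h u v x y huv hxy
  refine Set.ncard_le_ncard_of_injOn (Prod.map φ φ) ?_
    (φ.injective.prodMap φ.injective).injOn (Set.toFinite _)
  rintro ⟨p, q⟩ ⟨h1, h2, h3, h4, h5⟩
  exact ⟨φ.map_adj_iff.2 h1, φ.map_adj_iff.2 h2, φ.map_adj_iff.2 h3, φ.injective.ne h4,
    φ.injective.ne h5⟩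

section JumpSet

variable {n : ℕ} {a b : ZMod n}

theorem mem_fourCycleCompletions (ha : a ≠ 0) (hb : b ≠ 0) {u v x y : ZMod n} :
    (x, y) ∈ fourCycleCompletions (twoJumpCirculant n a b) u v ↔
      (x - v = a ∨ x - v = -a ∨ x - v = b ∨ x - v = -b) ∧
      (y - x = a ∨ y - x = -a ∨ y - x = b ∨ y - x = -b) ∧
      (u - y = a ∨ u - y = -a ∨ u - y = b ∨ u - y = -b) ∧ x ≠ u ∧ y ≠ v := by
  simp only [fourCycleCompletions, Set.mem_ofPred_eq, twoJumpCirculant_adj ha hb,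
    Set.mem_insert_iff, Set.mem_singleton_iff]

set_option maxHeartbeats 2000000 in
-- Both kinds of dart lie on two parallelograms, but `4 * b = 0` adds the cycle `0, b, 2b, -b`
-- through `(0, b)`. So that dart has at least three completions and `(0, a)` at most two.
theorem not_isDartTransitive_of_four_mul_eq_zero (hn : 0 < n) (ha : 2 * a ≠ 0) (hb : 2 * b ≠ 0)
    (hab : a ≠ b) (hab' : a ≠ -b) (h1 : 2 * a ≠ 2 * b) (h2 : 2 * a ≠ -(2 * b))
    (h4 : 4 * b = 0) (h3 : 4 * a ≠ 0)
    (h5 : b ≠ 3 * a) (h6 : b ≠ -(3 * a)) :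
    ¬ IsDartTransitive (twoJumpCirculant n a b) := by
  intro h
  have : NeZero n := ⟨hn.ne'⟩
  have ha0 : a ≠ 0 := by rintro rfl; simp at ha
  have hb0 : b ≠ 0 := by rintro rfl; simp at hb
  have hle := h.fourCycleCompletions_ncard_le (u := 0) (v := b) (x := 0) (y := a)
    ((twoJumpCirculant_adj ha0 hb0).2 (by simp)) ((twoJumpCirculant_adj ha0 hb0).2 (by simp))
  have hub : fourCycleCompletions (twoJumpCirculant n a b) 0 a ⊆
      (({(a + b, b), (a - b, -b)} : Finset (ZMod n × ZMod n)) : Set _) := by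
    rintro ⟨x, y⟩ hxy
    obtain ⟨hx, hy, hz, hx0, hy0⟩ := (mem_fourCycleCompletions ha0 hb0).1 hxy
    simp only [Finset.coe_insert, Finset.coe_singleton, Set.mem_insert_iff,
      Set.mem_singleton_iff, Prod.mk.injEq]
    clear hxy hle h
    rcases hx with hx | hx | hx | hx <;> rcases hz with hz | hz | hz | hz <;>
      obtain rfl := sub_eq_iff_eq_add.1 hx <;>
      obtain rfl := neg_eq_iff_eq_neg.1 ((zero_sub y).symm.trans hz) <;>
      first
      | exact absurd (by ring1) hx0
      | exact absurd (by ring1) hy0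
      | skip
    -- The middle edge closes the walk: either this is a listed parallelogram, or the equation is an
    -- excluded relation up to sign and `4 * b = 0`.
    all_goals rcases hy with hy | hy | hy | hy <;> first
      | exact Or.inl ⟨by ring1, by ring1⟩
      | exact Or.inr ⟨by ring1, by ring1⟩
      | exact (ha (by linear_combination hy)).elim
      | exact (ha (by linear_combination hy + h4)).elim
      | exact (ha (by linear_combination hy - h4)).elim
      | exact (ha (by linear_combination -hy)).elim
      | exact (ha (by linear_combination -hy + h4)).elim
      | exact (ha (by linear_combination -hy - h4)).elim
      | exact (hb (by linear_combination hy)).elim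
      | exact (hb (by linear_combination hy + h4)).elim
      | exact (hb (by linear_combination hy - h4)).elim
      | exact (hb (by linear_combination -hy)).elim
      | exact (hb (by linear_combination -hy + h4)).elim
      | exact (hb (by linear_combination -hy - h4)).elim
      | exact (hab (by linear_combination hy)).elim
      | exact (hab (by linear_combination hy + h4)).elim
      | exact (hab (by linear_combination hy - h4)).elim
      | exact (hab (by linear_combination -hy)).elim
      | exact (hab (by linear_combination -hy + h4)).elim
      | exact (hab (by linear_combination -hy - h4)).elim
      | exact (hab' (by linear_combination hy)).elim
      | exact (hab' (by linear_combination hy + h4)).elim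
      | exact (hab' (by linear_combination hy - h4)).elim
      | exact (hab' (by linear_combination -hy)).elim
      | exact (hab' (by linear_combination -hy + h4)).elim
      | exact (hab' (by linear_combination -hy - h4)).elim
      | exact (h1 (by linear_combination hy)).elim
      | exact (h1 (by linear_combination hy + h4)).elim
      | exact (h1 (by linear_combination hy - h4)).elim
      | exact (h1 (by linear_combination -hy)).elim
      | exact (h1 (by linear_combination -hy + h4)).elim
      | exact (h1 (by linear_combination -hy - h4)).elim
      | exact (h2 (by linear_combination hy)).elim
      | exact (h2 (by linear_combination hy + h4)).elim
      | exact (h2 (by linear_combination hy - h4)).elim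
      | exact (h2 (by linear_combination -hy)).elim
      | exact (h2 (by linear_combination -hy + h4)).elim
      | exact (h2 (by linear_combination -hy - h4)).elim
      | exact (h3 (by linear_combination hy)).elim
      | exact (h3 (by linear_combination hy + h4)).elim
      | exact (h3 (by linear_combination hy - h4)).elim
      | exact (h3 (by linear_combination -hy)).elim
      | exact (h3 (by linear_combination -hy + h4)).elim
      | exact (h3 (by linear_combination -hy - h4)).elim
      | exact (h5 (by linear_combination hy)).elim
      | exact (h5 (by linear_combination hy + h4)).elim
      | exact (h5 (by linear_combination hy - h4)).elim
      | exact (h5 (by linear_combination -hy)).elim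
      | exact (h5 (by linear_combination -hy + h4)).elim
      | exact (h5 (by linear_combination -hy - h4)).elim
      | exact (h6 (by linear_combination hy)).elim
      | exact (h6 (by linear_combination hy + h4)).elim
      | exact (h6 (by linear_combination hy - h4)).elim
      | exact (h6 (by linear_combination -hy)).elim
  have hlb : ((({(2 * b, -b), (a + b, a), (b - a, -a)} : Finset (ZMod n × ZMod n)) : Set _)) ⊆
      fourCycleCompletions (twoJumpCirculant n a b) 0 b := by
    simp only [Finset.coe_insert, Finset.coe_singleton]
    rintro p (rfl | rfl | rfl) <;> rw [mem_fourCycleCompletions ha0 hb0]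
    · exact ⟨.inr (.inr (.inl (by ring))), .inr (.inr (.inl (by linear_combination -h4))),
        .inr (.inr (.inl (by ring))), hb, fun h => hb (by linear_combination -h)⟩
    · exact ⟨.inl (by ring), .inr (.inr (.inr (by ring))), .inr (.inl (by ring)),
        fun h => hab' (by linear_combination h), hab⟩
    · exact ⟨.inr (.inl (by ring)), .inr (.inr (.inr (by ring))), .inl (by ring),
        fun h => hab (by linear_combination -h), fun h => hab' (by linear_combination -h)⟩
  have e1 := Set.ncard_le_ncard hub (Set.toFinite _)
  have e2 := Set.ncard_le_ncard hlb (Set.toFinite _)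
  rw [Set.ncard_coe_finset] at e1 e2
  have e3 := Finset.card_le_two (a := (a + b, b)) (b := (a - b, -b))
  have e4 : ({(2 * b, -b), (a + b, a), (b - a, -a)} : Finset (ZMod n × ZMod n)).card = 3 := by
    rw [Finset.card_eq_three]
    exact ⟨_, _, _, by simp; grind, by simp; grind, by simp; grind, rfl⟩
  omega

set_option maxHeartbeats 2000000 in
-- The relation `b = a + a + a` gives `(0, a)` at least five completions and `(0, b)` at most four.
-- The entry `(2 * b, -b)` in the upper bound allows for `4 * b = 0`.
theorem not_isDartTransitive_of_eq_three_mul (hn : 0 < n) (ha : 2 * a ≠ 0) (hb : 2 * b ≠ 0)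
    (hab : a ≠ b) (hab' : a ≠ -b) (h1 : 2 * a ≠ 2 * b) (h2 : 2 * a ≠ -(2 * b))
    (h3 : b = 3 * a) (h10 : 10 * a ≠ 0) :
    ¬ IsDartTransitive (twoJumpCirculant n a b) := by
  intro h
  have : NeZero n := ⟨hn.ne'⟩
  have ha0 : a ≠ 0 := by rintro rfl; simp at ha
  have hb0 : b ≠ 0 := by rintro rfl; simp at hb
  have hle := h.fourCycleCompletions_ncard_le (u := 0) (v := a) (x := 0) (y := b)
    ((twoJumpCirculant_adj ha0 hb0).2 (by simp)) ((twoJumpCirculant_adj ha0 hb0).2 (by simp))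
  have hub : fourCycleCompletions (twoJumpCirculant n a b) 0 b ⊆
      (({(2 * b, -b), (a + b, a), (b - a, a), (b - a, -a)} :
        Finset (ZMod n × ZMod n)) : Set _) := by
    rintro ⟨x, y⟩ hxy
    obtain ⟨hx, hy, hz, hx0, hy0⟩ := (mem_fourCycleCompletions ha0 hb0).1 hxy
    simp only [Finset.coe_insert, Finset.coe_singleton, Set.mem_insert_iff,
      Set.mem_singleton_iff, Prod.mk.injEq]
    clear hxy hle h
    have h4 : 4 * a ≠ 0 := fun h => hab' (by linear_combination h + h3)
    subst h3
    rcases hx with hx | hx | hx | hx <;> rcases hz with hz | hz | hz | hz <;>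
      obtain rfl := sub_eq_iff_eq_add.1 hx <;>
      obtain rfl := neg_eq_iff_eq_neg.1 ((zero_sub y).symm.trans hz) <;>
      first
      | exact absurd (by ring1) hx0
      | exact absurd (by ring1) hy0
      | skip
    all_goals rcases hy with hy | hy | hy | hy <;> first
      | exact Or.inl ⟨by ring1, by ring1⟩
      | exact Or.inr (Or.inl ⟨by ring1, by ring1⟩)
      | exact Or.inr (Or.inr (Or.inl ⟨by ring1, by ring1⟩))
      | exact Or.inr (Or.inr (Or.inr ⟨by ring1, by ring1⟩))
      | exact (ha (by linear_combination hy)).elim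
      | exact (ha (by linear_combination -hy)).elim
      | exact (h4 (by linear_combination hy)).elim
      | exact (h4 (by linear_combination -hy)).elim
      | exact (hb (by linear_combination hy)).elim
      | exact (hb (by linear_combination -hy)).elim
      | exact (h2 (by linear_combination hy)).elim
      | exact (h2 (by linear_combination -hy)).elim
      | exact (h10 (by linear_combination hy)).elim
      | exact (h10 (by linear_combination -hy)).elim
  have hlb : ((({(2 * a, b), (2 * a, -a), (a + b, b), (a - b, -a), (a - b, -b)} :
      Finset (ZMod n × ZMod n)) : Set _)) ⊆
      fourCycleCompletions (twoJumpCirculant n a b) 0 a := by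
    simp only [Finset.coe_insert, Finset.coe_singleton]
    have hab0 : a - b ≠ 0 := sub_ne_zero.2 hab
    have hna : -a ≠ a := fun h => ha (by linear_combination -h)
    rintro p (rfl | rfl | rfl | rfl | rfl) <;> rw [mem_fourCycleCompletions ha0 hb0]
    · exact ⟨.inl (by ring), .inl (by linear_combination h3), .inr (.inr (.inr (by ring))), ha,
        hab.symm⟩
    · exact ⟨.inl (by ring), .inr (.inr (.inr (by linear_combination h3))), .inl (by ring), ha, hna⟩
    · exact ⟨.inr (.inr (.inl (by ring))), .inr (.inl (by ring)), .inr (.inr (.inr (by ring))),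
        fun h => hab' (by linear_combination h), hab.symm⟩
    · exact ⟨.inr (.inr (.inr (by ring))), .inl (by linear_combination h3), .inl (by ring),
        hab0, hna⟩
    · exact ⟨.inr (.inr (.inr (by ring))), .inr (.inl (by ring)), .inr (.inr (.inl (by ring))),
        hab0, hab'.symm⟩
  have e1 := Set.ncard_le_ncard hub (Set.toFinite _)
  have e2 := Set.ncard_le_ncard hlb (Set.toFinite _)
  rw [Set.ncard_coe_finset] at e1 e2
  have e3 := Finset.card_le_four (a := (2 * b, -b)) (b := (a + b, a)) (c := (b - a, a))
    (d := (b - a, -a))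
  have e4 : ({(2 * a, b), (2 * a, -a), (a + b, b), (a - b, -a), (a - b, -b)} :
      Finset (ZMod n × ZMod n)).card = 5 := by
    rw [Finset.card_insert_of_notMem, Finset.card_insert_of_notMem,
      Finset.card_insert_of_notMem, Finset.card_insert_of_notMem, Finset.card_singleton] <;>
      simp only [Finset.mem_insert, Finset.mem_singleton, Prod.mk.injEq]
    · rintro ⟨-, h⟩
      exact hab (by linear_combination -h)
    · rintro (h | h)
      · exact hb (by linear_combination h.1)
      · exact hb (by linear_combination h.1)
    · rintro (h | h | h)
      · exact hab (by linear_combination h.1)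
      · exact hab' (by linear_combination h.1)
      · exact hab' (by linear_combination h.1)
    · rintro (h | h | h | h)
      · exact hab' (by linear_combination h.2)
      · exact hab (by linear_combination h.1)
      · exact hab' (by linear_combination h.1)
      · exact hab' (by linear_combination h.1)
  omega

end JumpSet

/-! ### Classification of the connection sets -/

section JumpSet

variable {n : ℕ} {a b : ZMod n}

/-- Since `d * a = d`, the term `d * y` is a multiple of `a`; so `a` is a unit, and dividing by it
leaves the jumps `1` and `m + 1`. -/
theorem twoJumpCirculant_iso_wreath_of_mul_eq (hn : 0 < n) {d : ZMod n} (hd : d ≠ 0)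
    (hd2 : 2 * d = 0) {x y : ZMod n} (hxy : a * x + (a + d) * y = 1) (hda : d * a = d) :
    ∃ m : ℕ, n = 2 * m ∧ Nonempty (twoJumpCirculant n a (a + d) ≃g
      twoJumpCirculant (2 * m) 1 ((m : ZMod (2 * m)) + 1)) := by
  obtain ⟨m, rfl, rfl⟩ := ZMod.eq_natCast_of_two_mul_eq_zero hn hd hd2
  have hu : a * (x + y + y * (m : ZMod (2 * m))) = 1 := by linear_combination hxy + y * hda
  have := twoJumpCirculant_iso_mul (Units.mkOfMulEqOne _ _ hu) 1 ((m : ZMod (2 * m)) + 1)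
  refine ⟨m, rfl, ?_⟩
  have e : a * ((m : ZMod (2 * m)) + 1) = a + m := by linear_combination hda
  simpa [e] using this

theorem twoJumpCirculant_iso_of_two_mul_eq (hn : 0 < n) (hab : a ≠ b) (h : 2 * a = 2 * b)
    {x y : ZMod n} (hxy : a * x + b * y = 1) :
    ∃ m : ℕ, n = 2 * m ∧ Nonempty (twoJumpCirculant n a b ≃g
      twoJumpCirculant (2 * m) 1 ((m : ZMod (2 * m)) + 1)) := by
  obtain ⟨d, rfl⟩ : ∃ d, b = a + d := ⟨b - a, by ring⟩
  have hd2 : 2 * d = 0 := by linear_combination -h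
  have hd : d ≠ 0 := by rintro rfl; simp at hab
  rcases ZMod.mul_eq_zero_or_self_of_two_mul_eq_zero hd2 a with ha | ha
  -- If `d` killed both jumps it would kill `1`. If it fixes only `a + d`, the jumps exchange roles,
  -- as `a + d + d = a`.
  · rcases ZMod.mul_eq_zero_or_self_of_two_mul_eq_zero hd2 (a + d) with hb | hb
    · exact absurd (by linear_combination -d * hxy + x * ha + y * hb) hd
    · have e : a + d + d = a := by linear_combination hd2
      have := twoJumpCirculant_iso_wreath_of_mul_eq (a := a + d) (x := y) (y := x) hn hd hd2
        (by rw [e]; linear_combination hxy) hb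
      rwa [e, twoJumpCirculant_comm] at this
  · exact twoJumpCirculant_iso_wreath_of_mul_eq hn hd hd2 hxy ha

/-- With `b = u * a` the Bézout relation makes `a` a unit, which can be cancelled from `u ^ 2 * a =
±a`. -/
theorem twoJumpCirculant_iso_of_mul_unit (u : ZMod n) (hb : u * a = b) (hb2 : u * b = a ∨ u * b = -a)
    {x y : ZMod n} (hxy : a * x + b * y = 1) :
    ∃ c : ZMod n, (c ^ 2 = 1 ∨ c ^ 2 = -1) ∧
      Nonempty (twoJumpCirculant n a b ≃g twoJumpCirculant n 1 c) := by
  subst hb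
  refine ⟨u, ?_, ?_⟩
  · rcases hb2 with h | h
    · left; linear_combination (1 - u ^ 2) * hxy + (x + u * y) * h
    · right; linear_combination (-1 - u ^ 2) * hxy + (x + u * y) * h
  · have hu : a * (x + u * y) = 1 := by linear_combination hxy
    have := twoJumpCirculant_iso_mul (Units.mkOfMulEqOne _ _ hu) 1 u
    simpa [mul_comm a] using this

/-- In the nondegenerate case an automorphism taking the dart `(0, a)` to `(0, b)` is
multiplication by a unit, which squares to `±1`. -/
theorem IsDartTransitive.twoJumpCirculant_iso_of_sum_unique
    (h : IsDartTransitive (twoJumpCirculant n a b)) (ha : 2 * a ≠ 0) (hb : 2 * b ≠ 0)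
    (hu : ∀ s ∈ ({a, -a, b, -b} : Set (ZMod n)), ∀ t ∈ ({a, -a, b, -b} : Set (ZMod n)),
      ∀ p ∈ ({a, -a, b, -b} : Set (ZMod n)), ∀ q ∈ ({a, -a, b, -b} : Set (ZMod n)),
      s + t = p + q → s + t ≠ 0 → p = s ∨ p = t)
    (hgen : AddSubgroup.closure ({a, -a, b, -b} : Set (ZMod n)) = ⊤) (hab : a ≠ b) (hab' : a ≠ -b) :
    ∃ c : ZMod n, (c ^ 2 = 1 ∨ c ^ 2 = -1) ∧
      Nonempty (twoJumpCirculant n a b ≃g twoJumpCirculant n 1 c) := by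
  have ha0 : a ≠ 0 := by rintro rfl; simp at ha
  have hb0 : b ≠ 0 := by rintro rfl; simp at hb
  obtain ⟨φ, h0, h1⟩ := h 0 a 0 b ((twoJumpCirculant_adj ha0 hb0).2 (by simp))
    ((twoJumpCirculant_adj ha0 hb0).2 (by simp))
  have hadd := circulantGraph_automorphism_map_add (zero_notMem_jumpSet ha0 hb0)
    neg_mem_jumpSet hu (by
      intro s hs he
      rcases hs with rfl | rfl | rfl | rfl
      · exact ha (by linear_combination he)
      · exact ha (by linear_combination -he)
      · exact hb (by linear_combination he)
      · exact hb (by linear_combination -he)) hgen φ h0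
  let f : ZMod n →+ ZMod n := ⟨⟨φ, h0⟩, hadd⟩
  have hmul : ∀ x, φ x = φ 1 * x := by
    intro x
    obtain ⟨k, rfl⟩ := ZMod.intCast_surjective x
    have := map_zsmul f k 1
    simpa [f, mul_comm] using this
  obtain ⟨x, y, hxy⟩ := exists_mul_add_mul_eq_one hgen
  refine twoJumpCirculant_iso_of_mul_unit (φ 1) (by rw [← hmul, h1]) ?_ hxy
  rw [← hmul]
  have hφb : φ b - 0 ∈ ({a, -a, b, -b} : Set (ZMod n)) := by
    rw [← twoJumpCirculant_adj ha0 hb0, ← h0, φ.map_adj_iff, twoJumpCirculant_adj ha0 hb0]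
    simp
  rw [sub_zero] at hφb
  -- The values `±b` are already taken, at `±a`.
  rcases hφb with h | h | h | h
  · exact .inl h
  · exact .inr h
  · exact absurd (φ.injective (h1.trans h.symm)) hab
  · have : φ (-a) = φ b := by rw [hmul, mul_neg, ← hmul, h1, h]
    exact absurd (by linear_combination -φ.injective this) hab'

theorem IsDartTransitive.twoJumpCirculant_iso_of_eq_three_mul (hn : 0 < n)
    (h : IsDartTransitive (twoJumpCirculant n a b)) (ha : 2 * a ≠ 0) (hb : 2 * b ≠ 0)
    (hab : a ≠ b) (hab' : a ≠ -b) (h1 : 2 * a ≠ 2 * b) (h2 : 2 * a ≠ -(2 * b)) (h3 : b = 3 * a)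
    {x y : ZMod n} (hxy : a * x + b * y = 1) :
    ∃ c : ZMod n, (c ^ 2 = 1 ∨ c ^ 2 = -1) ∧
      Nonempty (twoJumpCirculant n a b ≃g twoJumpCirculant n 1 c) := by
  -- Here `3 * b = 9 * a = -a`, so multiplication by `3` preserves the jumps.
  by_cases h10 : 10 * a = 0
  · exact twoJumpCirculant_iso_of_mul_unit 3 h3.symm
      (.inr (by linear_combination h10 + 3 * h3)) hxy
  · exact absurd h (not_isDartTransitive_of_eq_three_mul hn ha hb hab hab' h1 h2 h3 h10)

/-- The classification of connected dart-transitive two-jump circulants of valency four. -/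
theorem IsDartTransitive.twoJumpCirculant_classification (hn : 0 < n)
    (h : IsDartTransitive (twoJumpCirculant n a b)) (ha : 2 * a ≠ 0) (hb : 2 * b ≠ 0)
    (hab : a ≠ b) (hab' : a ≠ -b)
    (hgen : AddSubgroup.closure ({a, -a, b, -b} : Set (ZMod n)) = ⊤) :
    (∃ c : ZMod n, (c ^ 2 = 1 ∨ c ^ 2 = -1) ∧
      Nonempty (twoJumpCirculant n a b ≃g twoJumpCirculant n 1 c)) ∨
    ∃ m : ℕ, n = 2 * m ∧ Nonempty (twoJumpCirculant n a b ≃g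
      twoJumpCirculant (2 * m) 1 ((m : ZMod (2 * m)) + 1)) := by
  obtain ⟨x, y, hxy⟩ := exists_mul_add_mul_eq_one hgen
  by_cases h1 : 2 * a = 2 * b
  · exact .inr (twoJumpCirculant_iso_of_two_mul_eq hn hab h1 hxy)
  by_cases h2 : 2 * a = -(2 * b)
  · rw [← twoJumpCirculant_neg_right]
    exact .inr (twoJumpCirculant_iso_of_two_mul_eq (x := x) (y := -y) hn hab'
      (by linear_combination h2) (by linear_combination hxy))
  left
  have hnb : 2 * -b ≠ 0 := fun e => hb (by linear_combination -e)
  have hna : 2 * -a ≠ 0 := fun e => ha (by linear_combination -e)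
  have hba' : b ≠ -a := fun e => hab' (by linear_combination e)
  have h1' : 2 * a ≠ -(2 * -b) := fun e => h1 (by linear_combination e)
  have h2' : 2 * a ≠ 2 * -b := fun e => h2 (by linear_combination e)
  have h2b : 2 * b ≠ -(2 * a) := fun e => h2 (by linear_combination e)
  by_cases h5 : b = 3 * a
  · exact h.twoJumpCirculant_iso_of_eq_three_mul hn ha hb hab hab' h1 h2 h5 hxy
  by_cases h6 : b = -(3 * a)
  · rw [← twoJumpCirculant_neg_right] at h ⊢
    exact h.twoJumpCirculant_iso_of_eq_three_mul (x := x) (y := -y) hn ha hnb hab'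
      (by simpa using hab) h2' h1' (by linear_combination -h6) (by linear_combination hxy)
  by_cases h7 : a = 3 * b
  · rw [twoJumpCirculant_comm] at h ⊢
    exact h.twoJumpCirculant_iso_of_eq_three_mul (x := y) (y := x) hn hb ha hab.symm hba'
      (Ne.symm h1) h2b h7 (by linear_combination hxy)
  by_cases h8 : a = -(3 * b)
  · rw [twoJumpCirculant_comm, ← twoJumpCirculant_neg_right] at h ⊢
    exact h.twoJumpCirculant_iso_of_eq_three_mul (x := y) (y := -x) hn hb hna hba'
      (by simpa using hab.symm) (fun e => h2 (by linear_combination e))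
      (fun e => h1 (by linear_combination -e)) (by linear_combination -h8)
      (by linear_combination hxy)
  by_cases h4 : 4 * b = 0
  -- Then `2 * a` and `2 * b` would both be the unique involution.
  · by_cases h3 : 4 * a = 0
    · have : 2 * a = 2 * b := ZMod.eq_of_two_mul_eq_zero hn ha (by linear_combination h3) hb
        (by linear_combination h4)
      exact absurd this h1
    · exact absurd h (not_isDartTransitive_of_four_mul_eq_zero hn ha hb hab hab' h1 h2 h4 h3 h5 h6)
  by_cases h3 : 4 * a = 0
  · rw [twoJumpCirculant_comm] at h
    exact absurd h (not_isDartTransitive_of_four_mul_eq_zero hn hb ha hab.symm hba'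
      (Ne.symm h1) h2b h3 h4 h7 h8)
  exact h.twoJumpCirculant_iso_of_sum_unique ha hb
    (jumpSet_sum_unique ha hb hab hab' h1 h2 h3 h4 h5 h6 h7 h8) hgen hab hab'

/-- The jumps `±1`, `±a` form a subgroup of the units, which acts on the graph by multiplication. -/
theorem twoJumpCirculant_isEdgeTransitive (hn : 0 < n) (h : a ^ 2 = 1 ∨ a ^ 2 = -1) :
    IsEdgeTransitive (twoJumpCirculant n 1 a) := by
  have : NeZero n := ⟨hn.ne'⟩
  apply IsDartTransitive.isEdgeTransitive
  rcases subsingleton_or_nontrivial (ZMod n) with hs | hs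
  · intro u v x y huv
    exact absurd (Subsingleton.elim u v) huv.ne
  have ha0 : a ≠ 0 := by rintro rfl; simp at h
  have adj : ∀ {u v : ZMod n}, (twoJumpCirculant n 1 a).Adj u v ↔ v - u ∈ ({1, -1, a, -a} : Set _) :=
    twoJumpCirculant_adj one_ne_zero ha0
  have hmul : ∀ s ∈ ({1, -1, a, -a} : Set (ZMod n)), ∀ t ∈ ({1, -1, a, -a} : Set (ZMod n)),
      s * t ∈ ({1, -1, a, -a} : Set (ZMod n)) := by
    rcases h with h | h <;> rintro s (rfl | rfl | rfl | rfl) t (rfl | rfl | rfl | rfl) <;>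
      simp [← sq, h]
  have hinv : ∀ s ∈ ({1, -1, a, -a} : Set (ZMod n)), ∃ t ∈ ({1, -1, a, -a} : Set (ZMod n)),
      s * t = 1 := by
    rintro s (rfl | rfl | hs | rfl)
    · exact ⟨1, by simp, by simp⟩
    · exact ⟨-1, by simp, by simp⟩
    · rw [hs]
      rcases h with h | h
      · exact ⟨a, by simp, by linear_combination h⟩
      · exact ⟨-a, by simp, by linear_combination -h⟩
    · rcases h with h | h
      · exact ⟨-a, by simp, by linear_combination h⟩
      · exact ⟨a, by simp, by linear_combination -h⟩
  -- The affine map `z ↦ (v - u) * z + u` carries the dart `(0, 1)` to `(u, v)`.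
  have base : ∀ u v : ZMod n, (twoJumpCirculant n 1 a).Adj u v →
      ∃ φ : twoJumpCirculant n 1 a ≃g twoJumpCirculant n 1 a, φ 0 = u ∧ φ 1 = v := by
    intro u v huv
    have hs := adj.1 huv
    obtain ⟨t, ht, hst⟩ := hinv _ hs
    refine ⟨{ toEquiv := (Units.mkOfMulEqOne _ _ hst).mulLeft.trans (Equiv.addRight u)
              map_rel_iff' := ?_ }, ?_, ?_⟩
    · intro p q
      rw [adj, adj]
      have e : ∀ z, ((Units.mkOfMulEqOne _ _ hst).mulLeft.trans (Equiv.addRight u)) z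
        = (v - u) * z + u := fun _ => rfl
      rw [e, e, add_sub_add_right_eq_sub, ← mul_sub]
      refine ⟨fun h => ?_, hmul _ hs _⟩
      have := hmul _ ht _ h
      rwa [← mul_assoc, mul_comm t, hst, one_mul] at this
    · change (v - u) * 0 + u = u
      ring
    · change (v - u) * 1 + u = v
      ring
  intro u v x y huv hxy
  obtain ⟨φ, rfl, rfl⟩ := base u v huv
  obtain ⟨ψ, rfl, rfl⟩ := base x y hxy
  exact ⟨φ.symm.trans ψ, by simp, by simp⟩

end JumpSet

/-! ### Wreath graphs and the second family -/

section Wreath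

variable {m : ℕ}

theorem wreathGraph_adj {k : ℕ} (hm : 2 ≤ m) {x y : ZMod m × ZMod k} :
    (wreathGraph m k).Adj x y ↔ y.1 = x.1 + 1 ∨ x.1 = y.1 + 1 := by
  have : Fact (1 < m) := ⟨hm⟩
  simp only [wreathGraph, SimpleGraph.fromRel_adj, and_iff_right_iff_imp]
  rintro h rfl
  simp at h

theorem wreathGraph_isDartTransitive {k : ℕ} (hm : 2 ≤ m) :
    IsDartTransitive (wreathGraph m k) := by
  have : Fact (1 < m) := ⟨hm⟩
  have base : ∀ u v : ZMod m × ZMod k, (wreathGraph m k).Adj u v →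
      ∃ φ : wreathGraph m k ≃g wreathGraph m k, φ (0, 0) = u ∧ φ (1, 0) = v := by
    rintro ⟨i, r⟩ ⟨j, s⟩ huv
    -- Fibres can be shifted independently: `f` adjusts those over `0` and `1`, then a rotation or
    -- reflection of the base places the dart.
    let f : ZMod m → ZMod k := fun x => if x = 0 then r else s
    let e₁ : ZMod m × ZMod k ≃ ZMod m × ZMod k :=
      (Equiv.refl (ZMod m)).prodShear fun x => Equiv.addRight (f x)
    rcases (wreathGraph_adj hm).1 huv with h | h
    · refine ⟨⟨e₁.trans ((Equiv.addRight i).prodCongr (Equiv.refl _)), ?_⟩, ?_, ?_⟩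
      · rintro ⟨p, t⟩ ⟨q, t'⟩
        simp only [wreathGraph_adj hm]
        simp [e₁, add_right_comm _ i (1 : ZMod m)]
      · simp [e₁, f]
      · simp only at h
        simp [e₁, f, h, add_comm]
    · refine ⟨⟨e₁.trans ((Equiv.subLeft i).prodCongr (Equiv.refl _)), ?_⟩, ?_, ?_⟩
      · rintro ⟨p, t⟩ ⟨q, t'⟩
        simp only [wreathGraph_adj hm]
        have e : ∀ p q : ZMod m, i - p = i - q + 1 ↔ q = p + 1 := fun p q =>
          ⟨fun h => by linear_combination h, fun h => by linear_combination h⟩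
        simp [e₁, e, or_comm]
      · simp [e₁, f]
      · simp only at h
        simp [e₁, f, h]
  intro u v x y huv hxy
  obtain ⟨φ, rfl, rfl⟩ := base u v huv
  obtain ⟨ψ, rfl, rfl⟩ := base x y hxy
  exact ⟨φ.symm.trans ψ, by simp, by simp⟩

theorem castHom_two_mul_eq_zero_iff (hm : 0 < m) (x : ZMod (2 * m)) :
    ZMod.castHom (dvd_mul_left m 2) (ZMod m) x = 0 ↔ x = 0 ∨ x = (m : ZMod (2 * m)) := by
  have : NeZero (2 * m) := ⟨by omega⟩
  constructor
  · intro h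
    have hx : (x.val : ZMod (2 * m)) = x := by simp
    rw [← hx, map_natCast, ZMod.natCast_eq_zero_iff] at h
    obtain ⟨k, hk⟩ := h
    have hlt := x.val_lt
    have hk2 : k < 2 := by
      by_contra! hk2
      nlinarith
    rw [← hx]
    interval_cases k
    · left; simp [hk]
    · right; simp [hk]
  · rintro (rfl | rfl) <;> simp

theorem two_mul_natCast_eq_zero : (2 : ZMod (2 * m)) * (m : ZMod (2 * m)) = 0 := by
  have := ZMod.natCast_self (2 * m)
  push_cast at this
  exact this

/-- Reduction mod `m` has kernel `{0, m}`, so the jump set is the full preimage of `{1, -1}`;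
adjacency depends only on residues mod `m`. -/
theorem mem_wreath_jumpSet_iff (hm : 0 < m) (x : ZMod (2 * m)) :
    x ∈ ({1, -1, (m : ZMod (2 * m)) + 1, -((m : ZMod (2 * m)) + 1)} : Set (ZMod (2 * m))) ↔
      ZMod.castHom (dvd_mul_left m 2) (ZMod m) x = 1 ∨
        ZMod.castHom (dvd_mul_left m 2) (ZMod m) x = -1 := by
  have h2 := two_mul_natCast_eq_zero (m := m)
  have e1 := castHom_two_mul_eq_zero_iff hm (x - 1)
  have e2 := castHom_two_mul_eq_zero_iff hm (x + 1)
  rw [map_sub, map_one, sub_eq_zero, sub_eq_zero, sub_eq_iff_eq_add] at e1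
  rw [map_add, map_one, ← eq_neg_iff_add_eq_zero, ← eq_neg_iff_add_eq_zero] at e2
  rw [e1, e2]
  have e3 : x + 1 = (m : ZMod (2 * m)) ↔ x = -((m : ZMod (2 * m)) + 1) :=
    ⟨fun h => by linear_combination h + h2, fun h => by linear_combination h - h2⟩
  rw [e3]
  simp only [Set.mem_insert_iff, Set.mem_singleton_iff]
  tauto

theorem ZMod.two_ne_zero_of_three_le (hm : 3 ≤ m) : (2 : ZMod m) ≠ 0 := by
  intro h
  have : ((2 : ℕ) : ZMod m) = 0 := by exact_mod_cast h
  rw [ZMod.natCast_eq_zero_iff] at this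
  exact absurd (Nat.le_of_dvd (by norm_num) this) (by omega)

theorem twoJumpCirculant_wreath_isTetravalent (hm : 3 ≤ m) :
    IsTetravalent (twoJumpCirculant (2 * m) 1 ((m : ZMod (2 * m)) + 1)) := by
  have : Fact (1 < m) := ⟨by omega⟩
  have : Fact (1 < 2 * m) := ⟨by omega⟩
  set c := ZMod.castHom (dvd_mul_left m 2) (ZMod m)
  have h2 : (2 : ZMod m) ≠ 0 := ZMod.two_ne_zero_of_three_le hm
  have hm0 : (m : ZMod (2 * m)) ≠ 0 := by
    rw [Ne, ZMod.natCast_eq_zero_iff]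
    exact fun h => absurd (Nat.le_of_dvd (by omega) h) (by omega)
  have hc : c (m : ZMod (2 * m)) = 0 := by simp
  have hb0 : (m : ZMod (2 * m)) + 1 ≠ 0 := fun h => by
    have := congrArg c h
    simp only [map_add, hc, map_one, map_zero, zero_add] at this
    exact one_ne_zero this
  intro v
  rw [twoJumpCirculant, circulantGraph_neighborSet_ncard (zero_notMem_jumpSet one_ne_zero hb0)
    neg_mem_jumpSet]
  -- For `m ≥ 3` reduction mod `m` separates `1, m + 1` from their negatives.
  have key : ∀ x y : ZMod (2 * m), c x = 1 → c y = -1 → x ≠ y := by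
    rintro x _ hx hy rfl
    rw [hx] at hy
    exact h2 (by linear_combination hy)
  have h1 : (1 : ZMod (2 * m)) ≠ (m : ZMod (2 * m)) + 1 := fun h =>
    hm0 (by linear_combination -h)
  rw [Set.ncard_insert_of_notMem, Set.ncard_insert_of_notMem, Set.ncard_pair]
  · exact key _ _ (by simp) (by simp)
  · simp only [Set.mem_insert_iff, Set.mem_singleton_iff, not_or]
    exact ⟨(key _ _ (by simp) (by simp)).symm, fun h => h1 (by linear_combination -h)⟩
  · simp only [Set.mem_insert_iff, Set.mem_singleton_iff, not_or]
    exact ⟨key _ _ (by simp) (by simp), h1, key _ _ (by simp) (by simp)⟩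

theorem twoJumpCirculant_iso_wreathGraph (hm : 3 ≤ m) :
    Nonempty (twoJumpCirculant (2 * m) 1 ((m : ZMod (2 * m)) + 1) ≃g wreathGraph m 2) := by
  have : Fact (1 < 2 * m) := ⟨by omega⟩
  have : NeZero m := ⟨by omega⟩
  have : NeZero (2 * m) := ⟨by omega⟩
  set c := ZMod.castHom (dvd_mul_left m 2) (ZMod m)
  -- The second coordinate records which of the two lifts of the residue `x` is.
  let f : ZMod (2 * m) → ZMod m × ZMod 2 := fun x => (c x, if x.val < m then 0 else 1)
  have hf : Function.Injective f := by
    intro x y hxy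
    obtain ⟨h1, h2⟩ := Prod.mk.injEq .. ▸ hxy
    have hval : ∀ z : ZMod (2 * m), c z = (z.val : ZMod m) := fun z => by
      rw [← map_natCast c, ZMod.natCast_zmod_val]
    rw [hval, hval, ZMod.natCast_eq_natCast_iff'] at h1
    have hx := x.val_lt
    have hy := y.val_lt
    have hmod : ∀ k, k < 2 * m → k % m = if k < m then k else k - m := by
      intro k hk
      split_ifs with hlt
      · exact Nat.mod_eq_of_lt hlt
      · rw [Nat.mod_eq_sub_mod (by omega), Nat.mod_eq_of_lt (by omega)]
    rw [hmod _ hx, hmod _ hy] at h1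
    apply ZMod.val_injective
    split_ifs at h1 h2 <;> first | omega | simp at h2
  have hbij : Function.Bijective f :=
    (Fintype.bijective_iff_injective_and_card f).2 ⟨hf, by simp [ZMod.card, mul_comm]⟩
  refine ⟨{ toEquiv := Equiv.ofBijective f hbij, map_rel_iff' := ?_ }⟩
  intro x y
  have hb0 : (m : ZMod (2 * m)) + 1 ≠ 0 := fun h => by
    have : Fact (1 < m) := ⟨by omega⟩
    have := congrArg c h
    simp [c] at this
  rw [twoJumpCirculant_adj one_ne_zero hb0, mem_wreath_jumpSet_iff (by omega), map_sub,
    wreathGraph_adj (by omega)]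
  change c y = c x + 1 ∨ c x = c y + 1 ↔ c y - c x = 1 ∨ c y - c x = -1
  refine or_congr ?_ ?_
  · rw [sub_eq_iff_eq_add']
  · exact ⟨fun h => by linear_combination -h, fun h => by linear_combination -h⟩

end Wreath

/-! ### The main theorem -/

theorem theorem1 :
    -- the classification
    (∀ (V : Type*) (Γ : SimpleGraph V) (n : ℕ), 0 < n →
      IsCirculant Γ n → IsTetravalent Γ → IsEdgeTransitive Γ →
        IsDartTransitive Γ ∧
        (Γ.Connected →
          (∃ a : ZMod n, (a ^ 2 = 1 ∨ a ^ 2 = -1) ∧ Nonempty (Γ ≃g twoJumpCirculant n 1 a)) ∨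
          (∃ m : ℕ, n = 2 * m ∧
            Nonempty (Γ ≃g twoJumpCirculant (2 * m) 1 ((m : ZMod (2 * m)) + 1))))) ∧
    -- the graphs in the first family are edge-transitive
    (∀ (n : ℕ) (a : ZMod n), 0 < n → (a ^ 2 = 1 ∨ a ^ 2 = -1) →
      IsEdgeTransitive (twoJumpCirculant n 1 a)) ∧
    -- the graphs in the second family are tetravalent wreath graphs, and edge-transitive
    (∀ m : ℕ, 3 ≤ m →
      IsTetravalent (twoJumpCirculant (2 * m) 1 ((m : ZMod (2 * m)) + 1)) ∧
      IsEdgeTransitive (twoJumpCirculant (2 * m) 1 ((m : ZMod (2 * m)) + 1)) ∧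
      Nonempty (twoJumpCirculant (2 * m) 1 ((m : ZMod (2 * m)) + 1) ≃g wreathGraph m 2)) := by
  refine ⟨?_, fun n a hn h => twoJumpCirculant_isEdgeTransitive hn h, fun m hm => ?_⟩
  · rintro V Γ n hn ⟨S, h0, hS, ⟨e⟩⟩ h4 hE
    have hD := circulantGraph_isDartTransitive h0 hS (hE.of_iso e)
    refine ⟨hD.of_iso e.symm, fun hconn => ?_⟩
    have hcard : S.ncard = 4 := by
      rw [← circulantGraph_neighborSet_ncard h0 hS 0]
      exact h4.of_iso e 0
    have hgen := circulantGraph_closure_eq_top h0 hS (e.connected_iff.1 hconn)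
    obtain ⟨a, b, rfl, ha, hb, hab, hab'⟩ := ZMod.exists_eq_of_ncard_eq_four hn h0 hS hcard
    rcases IsDartTransitive.twoJumpCirculant_classification hn hD ha hb hab hab' hgen with
      ⟨c, hc, ⟨f⟩⟩ | ⟨m, hm, ⟨f⟩⟩
    · exact .inl ⟨c, hc, ⟨e.trans f⟩⟩
    · exact .inr ⟨m, hm, ⟨e.trans f⟩⟩
  · obtain ⟨f⟩ := twoJumpCirculant_iso_wreathGraph hm
    exact ⟨twoJumpCirculant_wreath_isTetravalent hm,
      (wreathGraph_isDartTransitive (by omega)).isEdgeTransitive.of_iso f.symm, ⟨f⟩⟩
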